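/- Fix $\tau\in(2,3)$, $\alpha=1/(\tau-1)$ and $\lambda\in(0,\infty)$. For each $n\ge 1$ let $\boldsymbol d=\boldsymbol d_n=(d_1,\dots,d_n)$ be a sequence of non-negative integers with $d_1\ge d_2\ge\dots\ge d_n$ and $\sum_{i\in[n]}d_i$ even (the $d_i$ may depend on $n$). Suppose that (i) for every fixed $i\ge 1$, $n^{-\alpha}d_i\to\theta_i$ as $n\to\infty$, where $\theta_1\ge\theta_2\ge\dots\ge 0$, $\sum_i\theta_i^2<\infty$, $\sum_i\theta_i=\infty$, and for every $t>0$, $\int_0^\infty e^{-tv^2M_t(v)}\,\mathrm dv<\infty$ with $M_t(v)=\sum_{j:\,v\theta_j\le 1,\ t\theta_j\le 1}\theta_j^3$; (ii) if $D_n$ is the degree of a uniformly chosen vertex of $[n]$, then $(D_n)_{n\ge1}$ is uniformly integrable; $\frac1n\sum_{i\in[n]}d_i\to\mu$ for some $\mu>0$; and $\lim_{K\to\infty}\limsup_{n\to\infty}n^{-2\alpha}\sum_{i=K+1}^n d_i^2=0$. Let $\nu_n=\sum_{i\in[n]}d_i(d_i-1)/\sum_{i\in[n]}d_i$, and let $p_n\in[0,1]$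 satisfy $p_n=\frac{\lambda}{\nu_n}(1+o(1))$ as $n\to\infty$. Let $\mathrm{CM}_n(\boldsymbol d,p_n)$ be the random multigraph on $[n]$ obtained by attaching $d_i$ half-edges to each vertex $i$, pairing all half-edges by a uniformly random perfect matching (each pair forming an edge), and then retaining each edge independently with probability $p_n$. For a graph $G$, let $\mathrm{diam}(G)$ be the maximum, over the connected components of $G$, of the largest graph distance between two vertices of the component. Then $$\mathrm{diam}(\mathrm{CM}_n(\boldsymbol d,p_n))=O_{\mathbb P}(\log n),$$ i.e. for every $\varepsilon>0$ there is $K>0$ such that $\mathbb P\big(\mathrm{diam}(\mathrm{CM}_n(\boldsymbol d,p_n))>K\log n\big)\le\varepsilon$ for all $n\geq 1$. -/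

import Mathlib

open MeasureTheory ProbabilityTheory Filter Topology Asymptotics

noncomputable section

namespace PercolatedCM

/-! ### The configuration model and its percolation -/

/-- The half-edges of the degree sequence `d`: vertex `i` carries `d i` of them. -/
abbrev HalfEdge {n : ℕ} (d : Fin n → ℕ) : Type := Σ i : Fin n, Fin (d i)

/-- Pairings (perfect matchings) of `H`: involutions without fixed points; `x` is paired with the
image of `x`. -/
def Pairing (H : Type) : Type := {f : H → H // Function.Involutive f ∧ ∀ x, f x ≠ x}

instance (H : Type) : MeasurableSpace (Pairing H) := ⊤

/-- The edges created by a pairing: the unordered pairs `{x, f x}` of half-edges. Edges between the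
same vertices made of different half-edges are different, so this is a multigraph with loops. -/
def Pairing.edges {H : Type} (M : Pairing H) : Set (Sym2 H) := Set.range fun x => s(x, M.1 x)

/-- The law of the percolated configuration model, as a random set of edges, an edge being an
unordered pair of half-edges: a uniformly random pairing of the half-edges is drawn, and each of its
edges is then retained independently with probability `p`. -/
def law {n : ℕ} (d : Fin n → ℕ) (p : unitInterval) : Measure (Set (Sym2 (HalfEdge d))) :=
  (uniformOn (Set.univ : Set (Pairing (HalfEdge d)))).bind fun M => setBernoulli M.edges p

/-- The simple graph on the vertex set with the same adjacency between distinct vertices as the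
multigraph with edge set `S`; components and graph distances agree for the two. -/
def graph {n : ℕ} {d : Fin n → ℕ} (S : Set (Sym2 (HalfEdge d))) : SimpleGraph (Fin n) :=
  SimpleGraph.fromEdgeSet (Sym2.map Sigma.fst '' S)

/-- The maximum of the diameters of the connected components of a (finite) graph. -/
def maxDiam {V : Type} (G : SimpleGraph V) : ℕ :=
  ⨆ C : G.ConnectedComponent, C.toSimpleGraph.diam

/-! ### Assumptions on the degrees -/

/-- `ℓ_n = ∑ d_i`. -/
def totalDegree {n : ℕ} (d : Fin n → ℕ) : ℕ := ∑ i, d i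

/-- The criticality parameter `ν_n = ∑ d_i (d_i - 1) / ∑ d_i`. -/
def nu {n : ℕ} (d : Fin n → ℕ) : ℝ :=
  (∑ i, (d i : ℝ) * ((d i : ℝ) - 1)) / ∑ i, (d i : ℝ)

/-- The degree of the `i`-th vertex, counting from `0` (and `0` if there is no such vertex). -/
def degAt {n : ℕ} (d : Fin n → ℕ) (i : ℕ) : ℕ := if h : i < n then d ⟨i, h⟩ else 0

/-- `M_t(v) = ∑ θ_j ^ 3`, the sum over the `j` with `v θ_j ≤ 1` and `t θ_j ≤ 1`. -/
def truncatedCubes (θ : ℕ → ℝ) (t v : ℝ) : ℝ :=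
  ∑' j, Set.indicator {j | v * θ j ≤ 1 ∧ t * θ j ≤ 1} (fun j => θ j ^ 3) j

/-- The conditions on the limiting sequence `θ`: it is non-increasing, non-negative, in `ℓ²` but not
in `ℓ¹`, and `∫_0^∞ exp (- t v² M_t(v)) dv < ∞` for every `t > 0`. -/
structure IsAdmissible (θ : ℕ → ℝ) : Prop where
  antitone : Antitone θ
  nonneg : ∀ i, 0 ≤ θ i
  summable_sq : Summable fun i => θ i ^ 2
  not_summable : ¬ Summable θ
  density : ∀ t : ℝ, 0 < t →
    IntegrableOn (fun v => Real.exp (-(t * v ^ 2 * truncatedCubes θ t v))) (Set.Ioi 0)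

/-- The assumptions on the degree sequences `d n = (d_1 ≥ … ≥ d_n)`, with `α = 1 / (τ - 1)`. -/
structure DegreeAssumption (τ μ : ℝ) (θ : ℕ → ℝ) (d : ∀ n : ℕ, Fin n → ℕ) : Prop where
  antitone : ∀ n, Antitone (d n)
  even : ∀ n, Even (totalDegree (d n))
  admissible : IsAdmissible θ
  /-- `n ^ (-α) d_i → θ_i` for every fixed `i`. -/
  high_degree : ∀ i : ℕ,
    Tendsto (fun n : ℕ => (n : ℝ) ^ (-(1 / (τ - 1))) * (degAt (d n) i : ℝ)) atTop (𝓝 (θ i))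
  /-- Uniform integrability of the degree `D_n` of a uniformly chosen vertex: the supremum over `n`
  of `𝔼[D_n 1{D_n > K}]` tends to `0` as `K → ∞`. -/
  uniformIntegrable : Tendsto
    (fun K : ℕ => ⨆ n : ℕ, ENNReal.ofReal ((∑ i with K < d n i, (d n i : ℝ)) / n)) atTop (𝓝 0)
  mean_pos : 0 < μ
  mean : Tendsto (fun n : ℕ => (totalDegree (d n) : ℝ) / n) atTop (𝓝 μ)
  /-- `lim_{K → ∞} limsup_{n → ∞} n ^ (-2α) ∑_{i > K} d_i² = 0`. -/
  tail_sq : Tendsto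
    (fun K : ℕ => limsup (fun n : ℕ => ENNReal.ofReal
      ((n : ℝ) ^ (-(2 * (1 / (τ - 1)))) * ∑ i : Fin n with K ≤ i.val, (d n i : ℝ) ^ 2)) atTop)
    atTop (𝓝 0)

/-! ### Stochastic order of magnitude -/

/-- `f_n = O_ℙ(g_n)`: tightness of `|f_n| / |g_n|`, written without division. -/
def IsBigOP {Ω : ℕ → Type} [∀ n, MeasurableSpace (Ω n)] (P : ∀ n, Measure (Ω n))
    (f : ∀ n, Ω n → ℝ) (g : ℕ → ℝ) : Prop :=
  ∀ ε : ℝ, 0 < ε → ∃ K : ℝ, 0 < K ∧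
    ∀ n, P n {ω | K * |g n| < |f n ω|} ≤ ENNReal.ofReal ε

end PercolatedCM

end

noncomputable section

namespace PercolatedCM

/-! ### Counting pairings -/

/-! The few largest degrees carry almost all of `∑ d_i²`. Since `2α > 1`, `ν_n` is at least of order
`n^(2α) / ℓ_n`, while the squared degrees beyond the first `K` sum to at most `δ n^(2α)` with `δ` as
small as desired. As `p_n` is about `λ / ν_n`, a large fixed `K` makes `p_n ∑_{i > K} d_i² / ℓ_n` as
small as needed: away from `K` hubs, exploration is subcritical (`exists_mul_tailSq_le`).

A geodesic visits each hub at most once, so a large diameter forces a long path with no hub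
(`exists_path_avoiding`). The first moment method excludes such paths: there are at most `ℓ² A^r`
sequences of half-edges with `A` the tail sum (`ncard_chains_le`), and each is paired and retained
with probability at most `(p / b)^(r+1)`, `b ≈ ℓ / 2` (`ncard_matchingPairings_mul_pow_le`,
`setBernoulli_superset_le`). The expected number is `O(ℓ e^{-r})`, and `r ≈ 2 log n` suffices. -/

instance {H : Type} [Finite H] : Finite (Pairing H) := by
  unfold Pairing; infer_instance

/-- Relabelling the half-edges of a pairing by the transposition `Equiv.swap y z`. -/
def Pairing.swapConj {H : Type} [DecidableEq H] (y z : H) (M : Pairing H) : Pairing H :=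
  ⟨fun h => Equiv.swap y z (M.1 (Equiv.swap y z h)), by
    intro h
    simp [M.2.1 _], by
    intro h e
    apply M.2.2 (Equiv.swap y z h)
    exact (Equiv.swap y z).injective (by simpa using e)⟩

lemma Pairing.swapConj_injective {H : Type} [DecidableEq H] (y z : H) :
    Function.Injective (Pairing.swapConj y z) := by
  intro M N h
  apply Subtype.ext
  funext w
  have := congrFun (congrArg Subtype.val h) (Equiv.swap y z w)
  simpa [Pairing.swapConj] using this

/-- The pairings that pair `x i` with `y i` for every `i ∈ s`. -/
def matchingPairings {H ι : Type} (s : Finset ι) (x y : ι → H) : Set (Pairing H) :=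
  {M | ∀ i ∈ s, M.1 (x i) = y i}

/-- Prescribing `#s` disjoint pairs reduces the number of pairings by a factor at least
`b ^ #s`, as long as `b` is at most the number of partners left at each step. -/
lemma ncard_matchingPairings_mul_pow_le {H ι : Type} [Finite H] (s : Finset ι) (x y : ι → H)
    (hx : Set.InjOn x s) (hy : Set.InjOn y s) (hxy : ∀ i ∈ s, ∀ j ∈ s, x i ≠ y j)
    (b : ℕ) (hb : b + 2 * s.card ≤ Nat.card H + 1) :
    (matchingPairings s x y).ncard * b ^ s.card ≤ Nat.card (Pairing H) := by
  classical
  have := Fintype.ofFinite H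
  have := Fintype.ofFinite (Pairing H)
  induction s using Finset.induction_on with
  | empty => simp [matchingPairings, Set.ncard_univ]
  | insert a s ha ih =>
    rw [Finset.card_insert_of_notMem ha] at hb ⊢
    have ih' := ih (hx.mono (by simp)) (hy.mono (by simp))
      (fun i hi j hj => hxy i (by simp [hi]) j (by simp [hj])) (by omega)
    refine le_trans ?_ ih'
    rw [pow_succ', ← mul_assoc]
    refine Nat.mul_le_mul_right _ ?_
    -- For a partner `z` of `x a` outside this set, swapping `y a` and `z` leaves the pairs indexed
    -- by `s` intact and redirects `x a` to `z`. The fibres over distinct `z` are disjoint, and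
    -- there are at least `b` of them.
    set used : Finset H := insert (x a) (s.image x ∪ s.image y)
    have hused : used.card ≤ 2 * s.card + 1 := by
      refine (Finset.card_insert_le _ _).trans ?_
      have := Finset.card_union_le (s.image x) (s.image y)
      have h1 := Finset.card_image_le (s := s) (f := x)
      have h2 := Finset.card_image_le (s := s) (f := y)
      omega
    have hfree : b ≤ usedᶜ.card := by
      rw [Finset.card_compl, ← Nat.card_eq_fintype_card]
      omega
    have key : ∀ z ∈ usedᶜ, (matchingPairings (insert a s) x y).ncard ≤
        {M ∈ matchingPairings s x y | M.1 (x a) = z}.ncard := by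
      intro z hz
      simp only [used, Finset.mem_compl, Finset.mem_insert, Finset.mem_union, Finset.mem_image,
        not_or, not_exists, not_and] at hz
      refine Set.ncard_le_ncard_of_injOn (Pairing.swapConj (y a) z) ?_
        (Pairing.swapConj_injective _ _).injOn (Set.toFinite _)
      intro M hM
      have fx : ∀ i ∈ insert a s, x i ≠ z → Equiv.swap (y a) z (x i) = x i := fun i hi h =>
        Equiv.swap_apply_of_ne_of_ne (hxy i hi a (by simp)) h
      refine ⟨fun i hi => ?_, ?_⟩
      · have hi' : i ∈ insert a s := by simp [hi]
        simp only [Pairing.swapConj]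
        rw [fx i hi' (hz.2.1 i hi), hM i hi']
        refine Equiv.swap_apply_of_ne_of_ne (fun e => ?_) (hz.2.2 i hi)
        exact ha (hy (by simp [hi]) (by simp) e ▸ hi)
      · simp only [Pairing.swapConj]
        rw [fx a (by simp) (fun e => hz.1 e.symm), hM a (by simp), Equiv.swap_apply_left]
    calc (matchingPairings (insert a s) x y).ncard * b
        ≤ (matchingPairings (insert a s) x y).ncard * usedᶜ.card := Nat.mul_le_mul_left _ hfree
      _ = ∑ z ∈ usedᶜ, (matchingPairings (insert a s) x y).ncard := by simp [mul_comm]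
      _ ≤ ∑ z ∈ usedᶜ, {M ∈ matchingPairings s x y | M.1 (x a) = z}.ncard :=
        Finset.sum_le_sum key
      _ = ∑ z ∈ usedᶜ, ((matchingPairings s x y).toFinset.filter fun M => M.1 (x a) = z).card := by
        refine Finset.sum_congr rfl fun z _ => ?_
        rw [Set.ncard_eq_toFinset_card']
        congr 1
        ext; simp
      _ ≤ (matchingPairings s x y).toFinset.card :=
        (Finset.sum_card_fiberwise_eq_card_filter _ _ fun M : Pairing H => M.1 (x a)).le.trans
          (Finset.card_filter_le _ _)
      _ = (matchingPairings s x y).ncard := (Set.ncard_eq_toFinset_card' _).symm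

/-! ### Bernoulli random sets -/

lemma setBernoulli_superset_le {ι : Type} [Finite ι] (u : Set ι) (p : unitInterval)
    (E : Finset ι) :
    setBernoulli u p {S | ∀ e ∈ E, e ∈ S} ≤ ENNReal.ofReal p ^ E.card := by
  rw [setBernoulli_apply']
  have : (fun q : ι → Prop => {i | q i}) ⁻¹' {S | ∀ e ∈ E, e ∈ S} =
      Set.pi E (fun _ => {True}) := by
    ext q; simp
  rw [this, Measure.infinitePi_pi _ (by measurability)]
  -- An element of `E` outside `u` is never selected, so `E ⊆ u` is not needed.
  refine Finset.prod_le_pow_card _ _ _ fun i _ => ?_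
  have hp : ((unitInterval.toNNReal p : NNReal) : ENNReal) = ENNReal.ofReal p := by
    rw [ENNReal.ofReal, Real.toNNReal_of_nonneg p.2.1]; rfl
  by_cases h : i ∈ u
  · simp [h, hp]
  · simp [h]

/-! ### Long paths in graphs -/

lemma exists_isPath_length_eq_maxDiam {n : ℕ} (hn : 0 < n) (G : SimpleGraph (Fin n)) :
    ∃ (u v : Fin n) (w : G.Walk u v), w.IsPath ∧ w.length = maxDiam G := by
  have : Nonempty (Fin n) := ⟨⟨0, hn⟩⟩
  have : Nonempty G.ConnectedComponent := ⟨G.connectedComponentMk ⟨0, hn⟩⟩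
  obtain ⟨C, hC⟩ := exists_eq_ciSup_of_finite (f := fun C : G.ConnectedComponent =>
    C.toSimpleGraph.diam)
  have : Nonempty C := C.connected_toSimpleGraph.nonempty
  obtain ⟨a, b, hab⟩ := C.toSimpleGraph.exists_dist_eq_diam
  obtain ⟨w, hw, hl⟩ := C.connected_toSimpleGraph.exists_path_of_dist a b
  refine ⟨_, _, w.map C.toSimpleGraph_hom, ?_, ?_⟩
  · exact hw.map Subtype.val_injective
  · rw [SimpleGraph.Walk.length_map, hl, hab, hC, maxDiam]

lemma maxDiam_le_pred {n : ℕ} (G : SimpleGraph (Fin n)) : maxDiam G ≤ n - 1 := by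
  rcases Nat.eq_zero_or_pos n with rfl | hn
  · have : IsEmpty G.ConnectedComponent := ⟨fun C => by
      induction C using SimpleGraph.ConnectedComponent.ind with | _ v => exact v.elim0⟩
    simp [maxDiam]
  · obtain ⟨u, v, w, hw, hl⟩ := exists_isPath_length_eq_maxDiam hn G
    have := hw.length_lt
    rw [Fintype.card_fin] at this
    omega

/-- A graph of large diameter contains a long path avoiding the first `K` vertices: these cut a
longest geodesic into at most `K + 1` pieces. -/
lemma exists_path_avoiding {n : ℕ} (hn : 0 < n) (G : SimpleGraph (Fin n)) (K r : ℕ)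
    (h : (K + 1) * (r + 2) ≤ maxDiam G) :
    ∃ v : ℕ → Fin n, Set.InjOn v (Set.Iio (r + 2)) ∧ (∀ i < r + 1, G.Adj (v i) (v (i + 1))) ∧
      ∀ i < r + 2, K ≤ (v i).val := by
  obtain ⟨a, b, w, hw, hl⟩ := exists_isPath_length_eq_maxDiam hn G
  have hinj := hw.getVert_injOn
  have hlt : ∀ k < K + 1, ∀ i < r + 2, k * (r + 2) + i < w.length := by
    intro k hk i hi
    have : (k + 1) * (r + 2) ≤ (K + 1) * (r + 2) := Nat.mul_le_mul_right _ hk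
    rw [add_mul, one_mul] at this
    omega
  -- Pigeonhole: `K + 1` disjoint blocks of `r + 2` path vertices cannot all meet the `K` hubs.
  -- Division by `r + 2` recovers the block from the position.
  have block : ∃ k < K + 1, ∀ i < r + 2, K ≤ (w.getVert (k * (r + 2) + i)).val := by
    by_contra! hcon
    choose! f hf hf' using hcon
    have hmaps : ∀ k ∈ Finset.range (K + 1),
        (w.getVert (k * (r + 2) + f k)).val ∈ Finset.range K := by
      intro k hk
      simpa using hf' k (by simpa using hk)
    obtain ⟨k, hk, l, hkl', hkl, he⟩ := Finset.exists_ne_map_eq_of_card_lt_of_maps_to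
      (by simp) hmaps
    rw [Finset.mem_range] at hk hkl'
    have h1 := hf k hk
    have h2 := hf l hkl'
    have e := hinj (hlt k hk _ h1).le (hlt l hkl' _ h2).le (Fin.ext he)
    apply hkl
    have e' := congrArg (· / (r + 2)) e
    simpa [Nat.add_div_of_dvd_right, Nat.mul_add_div, Nat.div_eq_of_lt h1, Nat.div_eq_of_lt h2,
      mul_comm _ (r + 2)] using e'
  obtain ⟨k, hk, hlow⟩ := block
  refine ⟨fun i => w.getVert (k * (r + 2) + i), ?_, ?_, hlow⟩
  · intro i hi j hj e
    have := hinj (hlt k hk i hi).le (hlt k hk j hj).le e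
    omega
  · intro i hi
    exact w.adj_getVert_succ (hlt k hk i (by omega))

/-! ### The first moment bound on long paths -/

/-- The possible sequences of half-edges `x₀ y₀ x₁ y₁ … x_r y_r` of a path with `r + 1` edges
`{x i, y i}` whose inner vertices are not among the first `K`. -/
def chains {n : ℕ} (d : Fin n → ℕ) (K r : ℕ) :
    Set ((Fin (r + 1) → HalfEdge d) × (Fin (r + 1) → HalfEdge d)) :=
  {q | Function.Injective q.1 ∧ Function.Injective q.2 ∧ (∀ i j, q.1 i ≠ q.2 j) ∧
    ∀ i : Fin r, (q.2 i.castSucc).1 = (q.1 i.succ).1 ∧ K ≤ (q.1 i.succ).1.val}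

/-- The sum of the squares of all degrees but the first `K`. -/
def tailSq {n : ℕ} (d : Fin n → ℕ) (K : ℕ) : ℕ := ∑ i : Fin n with K ≤ i.val, d i ^ 2

lemma card_halfEdge {n : ℕ} (d : Fin n → ℕ) : Fintype.card (HalfEdge d) = totalDegree d := by
  simp [totalDegree]

/-- Each inner vertex `v` is entered and left through one of `d_v²` ordered pairs of half-edges,
which gives a factor `tailSq d K`; the two extreme half-edges are free. Distinctness is dropped. -/
lemma ncard_chains_le {n : ℕ} (d : Fin n → ℕ) (K r : ℕ) :
    (chains d K r).ncard ≤ totalDegree d ^ 2 * tailSq d K ^ r := by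
  classical
  let T : Type := Σ v : {i : Fin n // K ≤ i.val}, Fin (d v) × Fin (d v)
  have hT : Fintype.card T = tailSq d K := by
    simp only [T, Fintype.card_sigma, Fintype.card_prod, Fintype.card_fin, tailSq]
    rw [Finset.sum_subtype (p := fun i : Fin n => K ≤ i.val) (F := inferInstance) _ (by simp)]
    simp [sq]
  let f : HalfEdge d × HalfEdge d × (Fin r → T) →
      (Fin (r + 1) → HalfEdge d) × (Fin (r + 1) → HalfEdge d) := fun t =>
    (Fin.cons t.1 fun i => ⟨(t.2.2 i).1, (t.2.2 i).2.2⟩,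
      Fin.snoc (α := fun _ => HalfEdge d) (fun i => ⟨(t.2.2 i).1, (t.2.2 i).2.1⟩) t.2.1)
  have hsub : chains d K r ⊆ Set.range f := by
    rintro ⟨x, y⟩ ⟨-, -, -, h⟩
    simp only at h
    refine ⟨(x 0, y (Fin.last r), fun i => ⟨⟨(x i.succ).1, (h i).2⟩,
      (Fin.cast (congrArg d (h i).1) (y i.castSucc).2, (x i.succ).2)⟩), ?_⟩
    refine Prod.ext ?_ ?_
    · funext i
      refine Fin.cases ?_ (fun i => ?_) i <;> simp [f]
    · funext i
      refine Fin.lastCases ?_ (fun i => ?_) i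
      · simp [f]
      · simp only [f, Fin.snoc_castSucc]
        refine Sigma.ext (h i).1.symm ?_
        rw [Fin.heq_ext_iff (congrArg d (h i).1.symm)]
        simp
  calc (chains d K r).ncard ≤ (Set.range f).ncard := Set.ncard_le_ncard hsub (Set.toFinite _)
    _ ≤ Nat.card (HalfEdge d × HalfEdge d × (Fin r → T)) := by
        rw [← Set.image_univ, ← Set.ncard_univ]
        exact Set.ncard_image_le (Set.toFinite _)
    _ = totalDegree d ^ 2 * tailSq d K ^ r := by
        rw [Nat.card_eq_fintype_card, Fintype.card_prod, Fintype.card_prod, Fintype.card_fun, hT,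
          card_halfEdge, Fintype.card_fin]
        ring

lemma exists_chain_of_le_maxDiam {n : ℕ} (hn : 0 < n) (d : Fin n → ℕ) (K r : ℕ)
    (M : Pairing (HalfEdge d)) (S : Set (Sym2 (HalfEdge d))) (hS : S ⊆ M.edges)
    (h : (K + 1) * (r + 2) ≤ maxDiam (graph S)) :
    ∃ q ∈ chains d K r, M ∈ matchingPairings Finset.univ q.1 q.2 ∧
      ∀ i, s(q.1 i, q.2 i) ∈ S := by
  obtain ⟨v, hinj, hadj, hlow⟩ := exists_path_avoiding hn (graph S) K r h
  have hedge : ∀ i : Fin (r + 1), ∃ x y : HalfEdge d, x.1 = v i ∧ y.1 = v (i + 1) ∧ s(x, y) ∈ S := by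
    intro i
    have := hadj i i.2
    rw [graph, SimpleGraph.fromEdgeSet_adj] at this
    obtain ⟨⟨e, he, hmap⟩, -⟩ := this
    induction e using Sym2.ind with
    | _ x y =>
      rw [Sym2.map_mk, Sym2.eq_iff] at hmap
      rcases hmap with ⟨h1, h2⟩ | ⟨h1, h2⟩
      · exact ⟨x, y, h1, h2, he⟩
      · exact ⟨y, x, h2, h1, Sym2.eq_swap ▸ he⟩
  choose x y hx hy hxy using hedge
  have hM : ∀ i, M.1 (x i) = y i := by
    intro i
    obtain ⟨z, hz⟩ := hS (hxy i)
    simp only [Sym2.eq_iff] at hz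
    rcases hz with ⟨h1, h2⟩ | ⟨h1, h2⟩
    · rw [← h1, h2]
    · rw [← h2, ← h1, M.2.1]
  have hv : ∀ i j : ℕ, i < r + 2 → j < r + 2 → v i = v j → i = j := fun i j hi hj e => hinj hi hj e
  refine ⟨(x, y), ⟨?_, ?_, ?_, ?_⟩, fun i _ => hM i, hxy⟩
  · intro i j e
    have e : x i = x j := e
    exact Fin.ext (hv _ _ (by omega) (by omega) (by rw [← hx, ← hx, e]))
  · intro i j e
    have e : y i = y j := e
    have := hv (i + 1) (j + 1) (by omega) (by omega) (by rw [← hy, ← hy, e])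
    exact Fin.ext (by omega)
  -- If `x i = y j`, positions give `i = j + 1`; applying the involution `M` gives `y i = x j`,
  -- hence `i + 1 = j`, a contradiction.
  · intro i j e
    have e : x i = y j := e
    have hij := hv i (j + 1) (by omega) (by omega) (by rw [← hx, ← hy, e])
    have hyx : y i = x j := by rw [← hM i, e, ← hM j, M.2.1]
    have hij' := hv (i + 1) j (by omega) (by omega) (by rw [← hx, ← hy, hyx])
    omega
  · intro i
    refine ⟨?_, ?_⟩
    · simp only [hx, hy]; simp
    · simp only [hx]; exact hlow _ (by simp)

lemma setBernoulli_chain_le {n : ℕ} (d : Fin n → ℕ) (K r : ℕ) (u : Set (Sym2 (HalfEdge d)))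
    (p : unitInterval) (q) (hq : q ∈ chains d K r) :
    setBernoulli u p {S | ∀ i, s(q.1 i, q.2 i) ∈ S} ≤ ENNReal.ofReal p ^ (r + 1) := by
  classical
  have hinj : Function.Injective fun i => s(q.1 i, q.2 i) := by
    intro i j e
    simp only [Sym2.eq_iff] at e
    rcases e with ⟨e, -⟩ | ⟨e, -⟩
    · exact hq.1 e
    · exact absurd e (hq.2.2.1 i j)
  have := setBernoulli_superset_le u p (Finset.univ.image fun i => s(q.1 i, q.2 i))
  rw [Finset.card_image_of_injective _ hinj] at this
  simpa using this

lemma uniformOn_matchingPairings_le {n : ℕ} (d : Fin n → ℕ) (K r b : ℕ) (hb0 : 0 < b)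
    (hb : b + 2 * (r + 1) ≤ totalDegree d + 1) (q) (hq : q ∈ chains d K r) :
    uniformOn (Set.univ : Set (Pairing (HalfEdge d))) (matchingPairings Finset.univ q.1 q.2) ≤
      ((b : ENNReal) ^ (r + 1))⁻¹ := by
  have := Fintype.ofFinite (Pairing (HalfEdge d))
  have hc := ncard_matchingPairings_mul_pow_le Finset.univ q.1 q.2 hq.1.injOn hq.2.1.injOn
    (fun i _ j _ => hq.2.2.1 i j) b (by
      rw [Nat.card_eq_fintype_card, card_halfEdge]; simpa using hb)
  have : MeasurableSingletonClass (Pairing (HalfEdge d)) := ⟨fun _ => trivial⟩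
  rw [uniformOn_univ, Measure.count_apply_finite _ (Set.toFinite _),
    ← Set.ncard_eq_toFinset_card _ (Set.toFinite _)]
  rw [Finset.card_univ, Fintype.card_fin, Nat.card_eq_fintype_card] at hc
  refine ENNReal.div_le_of_le_mul ?_
  rw [mul_comm, ← div_eq_mul_inv, ENNReal.le_div_iff_mul_le (by simp [hb0.ne']) (by simp)]
  exact_mod_cast hc

/-- Given the pairing `M`, the probability of a large diameter is at most the expected number of
retained chains. -/
lemma setBernoulli_le_maxDiam_le {n : ℕ} (hn : 0 < n) (d : Fin n → ℕ) (p : unitInterval)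
    (K r : ℕ) (I : Finset ((Fin (r + 1) → HalfEdge d) × (Fin (r + 1) → HalfEdge d)))
    (hI : ∀ q, q ∈ I ↔ q ∈ chains d K r) (M : Pairing (HalfEdge d)) :
    setBernoulli M.edges p {S | (K + 1) * (r + 2) ≤ maxDiam (graph S)} ≤
      ∑ q ∈ I, (matchingPairings Finset.univ q.1 q.2).indicator
        (fun _ => ENNReal.ofReal p ^ (r + 1)) M := by
  classical
  -- Chains can be extracted only from sets of edges of `M`, which carry all the mass.
  rw [setBernoulli_apply_eq_apply_subsets]
  calc setBernoulli M.edges p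
        {S ∈ {S | (K + 1) * (r + 2) ≤ maxDiam (graph S)} | S ⊆ M.edges}
      ≤ setBernoulli M.edges p (⋃ q ∈ I.filter
          fun q => M ∈ matchingPairings Finset.univ q.1 q.2,
          {S | ∀ i, s(q.1 i, q.2 i) ∈ S}) := by
        refine measure_mono ?_
        rintro S ⟨hSA, hS⟩
        obtain ⟨q, hq, hqM, hqS⟩ := exists_chain_of_le_maxDiam hn d K r M S hS hSA
        simp only [Set.mem_iUnion, Finset.mem_filter]
        exact ⟨q, ⟨(hI q).2 hq, hqM⟩, hqS⟩
    _ ≤ ∑ q ∈ I.filter fun q => M ∈ matchingPairings Finset.univ q.1 q.2,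
          setBernoulli M.edges p {S | ∀ i, s(q.1 i, q.2 i) ∈ S} :=
        measure_biUnion_finset_le _ _
    _ ≤ ∑ q ∈ I.filter fun q => M ∈ matchingPairings Finset.univ q.1 q.2,
          ENNReal.ofReal p ^ (r + 1) := by
        refine Finset.sum_le_sum fun q hq => setBernoulli_chain_le d K r _ p q ?_
        exact (hI q).1 (Finset.mem_filter.1 hq).1
    _ = _ := by
        rw [Finset.sum_filter]
        simp only [Set.indicator_apply]

/-- The probability that the percolated configuration model has a large diameter, bounded by the
expected number of long paths avoiding the first `K` vertices. -/
lemma law_le_maxDiam_le {n : ℕ} (hn : 0 < n) (d : Fin n → ℕ) (p : unitInterval) (K r b : ℕ)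
    (hb0 : 0 < b) (hb : b + 2 * (r + 1) ≤ totalDegree d + 1) :
    law d p {S | (K + 1) * (r + 2) ≤ maxDiam (graph S)} ≤
      (totalDegree d ^ 2 * tailSq d K ^ r : ℕ) *
        (ENNReal.ofReal p ^ (r + 1) * ((b : ENNReal) ^ (r + 1))⁻¹) := by
  obtain ⟨I, hI⟩ : ∃ I : Finset ((Fin (r + 1) → HalfEdge d) × (Fin (r + 1) → HalfEdge d)),
      (I : Set _) = chains d K r :=
    ⟨(Set.toFinite (chains d K r)).toFinset, Set.Finite.coe_toFinset _⟩
  have hI' : ∀ q, q ∈ I ↔ q ∈ chains d K r := fun q => by rw [← hI, Finset.mem_coe]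
  have hmeas : ∀ B : Set (Pairing (HalfEdge d)), MeasurableSet B := fun B => trivial
  rw [law, Measure.bind_apply (Set.toFinite _).measurableSet
    (Measurable.aemeasurable fun _ _ => hmeas _)]
  calc ∫⁻ M, setBernoulli M.edges p {S | (K + 1) * (r + 2) ≤ maxDiam (graph S)}
          ∂uniformOn (Set.univ : Set (Pairing (HalfEdge d)))
      ≤ ∫⁻ M, ∑ q ∈ I, (matchingPairings Finset.univ q.1 q.2).indicator
        (fun _ => ENNReal.ofReal p ^ (r + 1)) M ∂uniformOn Set.univ :=
        lintegral_mono (setBernoulli_le_maxDiam_le hn d p K r I hI')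
    _ = ∑ q ∈ I, ENNReal.ofReal p ^ (r + 1) *
        uniformOn Set.univ (matchingPairings Finset.univ q.1 q.2) := by
        rw [lintegral_finsetSum _ fun q _ => (fun _ _ => hmeas _)]
        refine Finset.sum_congr rfl fun q _ => ?_
        rw [lintegral_indicator (hmeas _), setLIntegral_const]
    _ ≤ ∑ q ∈ I, ENNReal.ofReal p ^ (r + 1) * ((b : ENNReal) ^ (r + 1))⁻¹ := by
        refine Finset.sum_le_sum fun q hq => ?_
        gcongr
        exact uniformOn_matchingPairings_le d K r b hb0 hb q ((hI' q).1 hq)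
    _ = (chains d K r).ncard * (ENNReal.ofReal p ^ (r + 1) * ((b : ENNReal) ^ (r + 1))⁻¹) := by
        rw [Finset.sum_const, nsmul_eq_mul, ← hI, Set.ncard_coe_finset]
    _ ≤ _ := by
        gcongr
        exact ncard_chains_le d K r

/-! ### Asymptotics of the degrees -/

lemma IsAdmissible.zero_pos {θ : ℕ → ℝ} (h : IsAdmissible θ) : 0 < θ 0 := by
  refine lt_of_le_of_ne (h.nonneg 0) fun h0 => h.not_summable ?_
  have : θ = fun _ => 0 :=
    funext fun i => le_antisymm ((h.antitone (Nat.zero_le i)).trans h0.symm.le) (h.nonneg i)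
  rw [this]
  exact summable_zero

section Degrees

variable {τ μ : ℝ} {θ : ℕ → ℝ} {d : ∀ n : ℕ, Fin n → ℕ}

lemma DegreeAssumption.exists_tailSq_le (hd : DegreeAssumption τ μ θ d) {δ : ℝ} (hδ : 0 < δ) :
    ∃ K : ℕ, ∀ᶠ n : ℕ in atTop, (tailSq (d n) K : ℝ) ≤ δ * (n : ℝ) ^ (2 * (1 / (τ - 1))) := by
  obtain ⟨K, hK⟩ := (hd.tail_sq.eventually_lt_const (ENNReal.ofReal_pos.2 hδ)).exists
  refine ⟨K, ?_⟩
  filter_upwards [eventually_lt_of_limsup_lt hK, eventually_gt_atTop 0] with n hn hn0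
  have hn' := (ENNReal.ofReal_lt_ofReal_iff hδ).1 hn
  have hpos : 0 < (n : ℝ) ^ (2 * (1 / (τ - 1))) := Real.rpow_pos_of_pos (by exact_mod_cast hn0) _
  rw [Real.rpow_neg (by positivity), inv_mul_lt_iff₀ hpos] at hn'
  rw [tailSq]
  push_cast
  linarith

lemma DegreeAssumption.eventually_totalDegree_mem (hd : DegreeAssumption τ μ θ d) :
    ∀ᶠ n : ℕ in atTop, μ / 2 * n ≤ totalDegree (d n) ∧ (totalDegree (d n) : ℝ) ≤ 2 * μ * n := by
  have hμ := hd.mean_pos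
  filter_upwards [hd.mean.eventually_const_lt (show μ / 2 < μ by linarith),
    hd.mean.eventually_lt_const (show μ < 2 * μ by linarith), eventually_gt_atTop 0] with n h1 h2 hn
  have hn' : (0 : ℝ) < n := by exact_mod_cast hn
  exact ⟨((lt_div_iff₀ hn').1 h1).le, ((div_lt_iff₀ hn').1 h2).le⟩

/-- The largest degree alone gives `θ_0² / 4 · n^(2α)`; subtracting `∑ d_i = O(n)` costs at most
half of it, because `τ < 3` means `2α > 1`. -/
lemma DegreeAssumption.eventually_le_sum (hd : DegreeAssumption τ μ θ d)
    (hτ : τ ∈ Set.Ioo (2 : ℝ) 3) :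
    ∀ᶠ n : ℕ in atTop, θ 0 ^ 2 / 8 * (n : ℝ) ^ (2 * (1 / (τ - 1))) ≤
      ∑ i, (d n i : ℝ) * ((d n i : ℝ) - 1) := by
  have hθ := hd.admissible.zero_pos
  set α := 1 / (τ - 1)
  have hα : 1 < 2 * α := by
    have : 0 < τ - 1 := by linarith [hτ.1]
    simp only [α]
    rw [mul_one_div, lt_div_iff₀ this]
    linarith [hτ.2]
  have hsmall : ∀ᶠ n : ℕ in atTop, 2 * μ * (n : ℝ) ≤ θ 0 ^ 2 / 8 * (n : ℝ) ^ (2 * α) := by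
    have h0 : Tendsto (fun n : ℕ => (n : ℝ) ^ (2 * α - 1)) atTop atTop :=
      (tendsto_rpow_atTop (by linarith)).comp tendsto_natCast_atTop_atTop
    filter_upwards [h0.eventually_ge_atTop (2 * μ / (θ 0 ^ 2 / 8)), eventually_gt_atTop 0]
      with n hn hn0
    have hn' : (0 : ℝ) < n := by exact_mod_cast hn0
    rw [div_le_iff₀' (by positivity)] at hn
    have e : (n : ℝ) ^ (2 * α) = (n : ℝ) ^ (2 * α - 1) * n := by
      rw [← Real.rpow_add_one hn'.ne']; congr 1; ring
    rw [e, ← mul_assoc]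
    exact mul_le_mul_of_nonneg_right hn hn'.le
  filter_upwards [hsmall, (hd.high_degree 0).eventually_const_lt (show θ 0 / 2 < θ 0 by linarith),
    hd.eventually_totalDegree_mem, eventually_gt_atTop 0] with n h1 h2 h3 hn
  have hn' : (0 : ℝ) < n := by exact_mod_cast hn
  have hpos : 0 < (n : ℝ) ^ α := Real.rpow_pos_of_pos hn' _
  rw [degAt, dif_pos hn, Real.rpow_neg hn'.le, lt_inv_mul_iff₀ hpos] at h2
  have hsq : (n : ℝ) ^ (2 * α) = ((n : ℝ) ^ α) ^ 2 := by
    rw [mul_comm, Real.rpow_mul hn'.le]; norm_num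
  have hd0 : θ 0 ^ 2 / 4 * (n : ℝ) ^ (2 * α) ≤ (d n ⟨0, hn⟩ : ℝ) ^ 2 := by
    rw [hsq]
    have := pow_le_pow_left₀ (by positivity) h2.le 2
    linarith
  have hsum : (d n ⟨0, hn⟩ : ℝ) ^ 2 ≤ ∑ i, (d n i : ℝ) ^ 2 :=
    Finset.single_le_sum (f := fun i => (d n i : ℝ) ^ 2) (fun i _ => by positivity)
      (Finset.mem_univ _)
  have hsplit : ∑ i, (d n i : ℝ) * ((d n i : ℝ) - 1) =
      ∑ i, (d n i : ℝ) ^ 2 - totalDegree (d n) := by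
    rw [totalDegree]
    push_cast
    rw [← Finset.sum_sub_distrib]
    exact Finset.sum_congr rfl fun i _ => by ring
  rw [hsplit]
  linarith [h3.2]

/-- Outside finitely many vertices the percolated configuration model is subcritical. -/
lemma DegreeAssumption.exists_mul_tailSq_le (hd : DegreeAssumption τ μ θ d)
    (hτ : τ ∈ Set.Ioo (2 : ℝ) 3) {lam : ℝ} (hlam : 0 < lam) {p : ℕ → unitInterval}
    (hp : (fun n => (p n : ℝ)) ~[atTop] fun n => lam / nu (d n)) {c : ℝ} (hc : 0 < c) :
    ∃ K : ℕ, ∀ᶠ n : ℕ in atTop, (p n : ℝ) * tailSq (d n) K ≤ c * totalDegree (d n) := by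
  have hθ := hd.admissible.zero_pos
  -- Chosen so that `2 λ δ = c θ_0² / 8`: the 2 comes from `p ≤ 2 λ / ν`, the 8 from
  -- `eventually_le_sum`.
  obtain ⟨K, hK⟩ := hd.exists_tailSq_le (δ := c * θ 0 ^ 2 / (16 * lam)) (by positivity)
  refine ⟨K, ?_⟩
  filter_upwards [hK, hd.eventually_le_sum hτ, hd.eventually_totalDegree_mem,
    hp.isLittleO.bound one_pos, eventually_gt_atTop 0] with n h1 h2 h3 h4 hn
  have hn' : (0 : ℝ) < n := by exact_mod_cast hn
  have hℓ : 0 < (totalDegree (d n) : ℝ) :=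
    lt_of_lt_of_le (mul_pos (half_pos hd.mean_pos) hn') h3.1
  set N := (n : ℝ) ^ (2 * (1 / (τ - 1)))
  have hN : 0 < N := Real.rpow_pos_of_pos hn' _
  set s := ∑ i, (d n i : ℝ) * ((d n i : ℝ) - 1) with hs
  have hs0 : 0 < s := lt_of_lt_of_le (by positivity) h2
  have hnu : nu (d n) = s / totalDegree (d n) := by rw [nu, totalDegree]; push_cast; rfl
  have hnu0 : 0 < lam / nu (d n) := by rw [hnu]; positivity
  have hpn : (p n : ℝ) ≤ 2 * lam * totalDegree (d n) / s := by
    simp only [Pi.sub_apply, Real.norm_eq_abs, one_mul, abs_of_pos hnu0] at h4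
    have := (abs_le.1 h4).2
    have e : lam / nu (d n) = lam * totalDegree (d n) / s := by rw [hnu]; field_simp
    rw [e] at this
    calc (p n : ℝ) ≤ 2 * (lam * totalDegree (d n) / s) := by linarith
      _ = _ := by ring
  have hA : 2 * lam * (tailSq (d n) K : ℝ) ≤ c * s := by
    calc 2 * lam * (tailSq (d n) K : ℝ) ≤ 2 * lam * (c * θ 0 ^ 2 / (16 * lam) * N) := by gcongr
      _ = c * (θ 0 ^ 2 / 8 * N) := by field_simp; ring
      _ ≤ c * s := by gcongr
  calc (p n : ℝ) * tailSq (d n) K ≤ 2 * lam * totalDegree (d n) / s * tailSq (d n) K := by gcongr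
    _ = 2 * lam * tailSq (d n) K * (totalDegree (d n) / s) := by ring
    _ ≤ c * s * (totalDegree (d n) / s) := by gcongr
    _ = c * totalDegree (d n) := by field_simp

/-! ### The diameter -/

lemma law_le_maxDiam_le_exp {n : ℕ} (hn : 0 < n) (d : Fin n → ℕ) (p : unitInterval) (K r : ℕ)
    (hr : 4 * (r + 1) ≤ totalDegree d)
    (hA : (p : ℝ) * tailSq d K ≤ Real.exp (-1) / 4 * totalDegree d) :
    law d p {S | (K + 1) * (r + 2) ≤ maxDiam (graph S)} ≤
      ENNReal.ofReal (4 * totalDegree d * Real.exp (-r)) := by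
  set ℓ := totalDegree d
  set A := tailSq d K
  have hb0 : 0 < ℓ / 2 := by omega
  refine (law_le_maxDiam_le hn d p K r (ℓ / 2) hb0 (by omega)).trans ?_
  have hp0 : (0 : ℝ) ≤ p := p.2.1
  set b : ℝ := ((ℓ / 2 : ℕ) : ℝ)
  have hb : 0 < b := by simp only [b]; exact_mod_cast hb0
  -- The factor 4 instead of 2 absorbs the rounding in `ℓ / 2`; it is the 4 in `hA`.
  have hbl : (ℓ : ℝ) ≤ 4 * b := by
    simp only [b]; exact_mod_cast (by omega : ℓ ≤ 4 * (ℓ / 2))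
  have hcast : ((ℓ ^ 2 * A ^ r : ℕ) : ENNReal) * (ENNReal.ofReal p ^ (r + 1) *
      (((ℓ / 2 : ℕ) : ENNReal) ^ (r + 1))⁻¹) =
      ENNReal.ofReal ((ℓ ^ 2 * A ^ r : ℕ) * ((p : ℝ) ^ (r + 1) * (b ^ (r + 1))⁻¹)) := by
    rw [ENNReal.ofReal_mul (by positivity), ENNReal.ofReal_mul (by positivity),
      ENNReal.ofReal_natCast, ENNReal.ofReal_pow hp0, ENNReal.ofReal_inv_of_pos (by positivity),
      ENNReal.ofReal_pow hb.le, ENNReal.ofReal_natCast]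
  rw [hcast]
  refine ENNReal.ofReal_le_ofReal ?_
  have hratio : (p : ℝ) * A / b ≤ Real.exp (-1) := by
    rw [div_le_iff₀ hb]
    nlinarith [Real.exp_pos (-1)]
  have hpow : ((p : ℝ) * A / b) ^ r ≤ Real.exp (-r) := by
    calc ((p : ℝ) * A / b) ^ r ≤ Real.exp (-1) ^ r := pow_le_pow_left₀ (by positivity) hratio r
      _ = Real.exp (-r) := by rw [← Real.exp_nat_mul]; congr 1; ring
  have hfirst : (ℓ : ℝ) ^ 2 * (p / b) ≤ 4 * ℓ := by
    rw [mul_div_assoc', div_le_iff₀ hb]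
    have : (p : ℝ) ≤ 1 := p.2.2
    calc (ℓ : ℝ) ^ 2 * p ≤ (ℓ : ℝ) ^ 2 * 1 := by gcongr
      _ = (ℓ : ℝ) * ℓ := by ring
      _ ≤ (ℓ : ℝ) * (4 * b) := by gcongr
      _ = 4 * (ℓ : ℝ) * b := by ring
  calc ((ℓ ^ 2 * A ^ r : ℕ) : ℝ) * ((p : ℝ) ^ (r + 1) * (b ^ (r + 1))⁻¹)
      = (ℓ : ℝ) ^ 2 * (p / b) * ((p : ℝ) * A / b) ^ r := by
        push_cast
        rw [div_pow, mul_pow]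
        field_simp
        ring
    _ ≤ 4 * ℓ * Real.exp (-r) := by gcongr

lemma DegreeAssumption.exists_eventually_law_le (hd : DegreeAssumption τ μ θ d)
    (hτ : τ ∈ Set.Ioo (2 : ℝ) 3) {lam : ℝ} (hlam : 0 < lam) {p : ℕ → unitInterval}
    (hp : (fun n => (p n : ℝ)) ~[atTop] fun n => lam / nu (d n)) {ε : ℝ} (hε : 0 < ε) :
    ∃ K : ℕ, ∀ᶠ n : ℕ in atTop, law (d n) (p n)
      {S | (K + 1) * (⌈2 * Real.log n⌉₊ + 2) ≤ maxDiam (graph S)} ≤ ENNReal.ofReal ε := by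
  have hμ := hd.mean_pos
  obtain ⟨K, hK⟩ := hd.exists_mul_tailSq_le hτ hlam hp
    (c := Real.exp (-1) / 4) (by positivity)
  refine ⟨K, ?_⟩
  -- With `n ≥ 32 / μ` this yields `4 (r + 1) ≤ 8 log n + 8 ≤ μ n / 2 ≤ ℓ`.
  have hlog : ∀ᶠ n : ℕ in atTop, Real.log n ≤ μ / 32 * n := by
    have := (Real.isLittleO_log_id_atTop.comp_tendsto tendsto_natCast_atTop_atTop).bound
      (show 0 < μ / 32 by positivity)
    filter_upwards [this] with n hn
    simp only [Function.comp_apply, id, Real.norm_eq_abs, Nat.abs_cast] at hn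
    exact (le_abs_self _).trans hn
  filter_upwards [hK, hd.eventually_totalDegree_mem, hlog, eventually_gt_atTop 0,
    tendsto_natCast_atTop_atTop.eventually_ge_atTop (32 / μ),
    tendsto_natCast_atTop_atTop.eventually_ge_atTop (8 * μ / ε)] with n h1 h2 h3 hn h4 h5
  have hn' : (0 : ℝ) < n := by exact_mod_cast hn
  have hlog0 : 0 ≤ Real.log n := Real.log_natCast_nonneg n
  set r := ⌈2 * Real.log n⌉₊
  have hr1 : (r : ℝ) < 2 * Real.log n + 1 := Nat.ceil_lt_add_one (by positivity)
  have hr2 : 2 * Real.log n ≤ r := Nat.le_ceil _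
  rw [div_le_iff₀ hμ] at h4
  rw [div_le_iff₀ hε] at h5
  have hr : 4 * (r + 1) ≤ totalDegree (d n) := by
    have : (4 * (r + 1) : ℝ) ≤ totalDegree (d n) := by nlinarith [h2.1]
    exact_mod_cast this
  refine (law_le_maxDiam_le_exp hn (d n) (p n) K r hr h1).trans (ENNReal.ofReal_le_ofReal ?_)
  have hexp : Real.exp (-r) ≤ ((n : ℝ) ^ 2)⁻¹ := by
    calc Real.exp (-r) ≤ Real.exp (-(2 * Real.log n)) := Real.exp_le_exp.2 (by linarith)
      _ = ((n : ℝ) ^ 2)⁻¹ := by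
        rw [Real.exp_neg, two_mul, Real.exp_add, Real.exp_log hn', sq]
  calc 4 * (totalDegree (d n) : ℝ) * Real.exp (-r)
      ≤ 4 * (2 * μ * n) * ((n : ℝ) ^ 2)⁻¹ := by
        gcongr
        exact h2.2
    _ = 8 * μ / n := by field_simp; ring
    _ ≤ ε := by rw [div_le_iff₀ hn']; linarith

end Degrees

end PercolatedCM

end

theorem theorem2 (τ μ lam : ℝ) (hτ : τ ∈ Set.Ioo (2 : ℝ) 3) (hlam : 0 < lam) (θ : ℕ → ℝ)
    (d : ∀ n : ℕ, Fin n → ℕ) (hd : PercolatedCM.DegreeAssumption τ μ θ d)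
    (p : ℕ → unitInterval)
    (hp : (fun n => (p n : ℝ)) ~[atTop] fun n => lam / PercolatedCM.nu (d n)) :
    PercolatedCM.IsBigOP (fun n => PercolatedCM.law (d n) (p n))
      (fun _ S => (PercolatedCM.maxDiam (PercolatedCM.graph S) : ℝ))
      (fun n => Real.log n) := by
  intro ε hε
  obtain ⟨K, hK⟩ := hd.exists_eventually_law_le hτ hlam hp hε
  obtain ⟨N, hN⟩ := eventually_atTop.1 hK
  have hlog2 : 0 < Real.log 2 := Real.log_pos one_lt_two
  -- The first term serves `n ≥ N + 3`, where `log n ≥ 1` and so `2 log n + 3 ≤ 5 log n`. The second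
  -- serves smaller `n` through the deterministic bound `n - 1`.
  set C : ℝ := 5 * (K + 1) + (N + 3) / Real.log 2 with hC
  refine ⟨C, by positivity, fun n => ?_⟩
  have hlogn : 0 ≤ Real.log n := Real.log_natCast_nonneg n
  simp only [abs_of_nonneg hlogn, Nat.abs_cast]
  rcases lt_or_ge n (N + 3) with hn | hn
  · have hle : ((n - 1 : ℕ) : ℝ) ≤ C * Real.log n := by
      -- For `n ≤ 1` both sides vanish, with the convention `Real.log 0 = 0`.
      rcases Nat.lt_or_ge n 2 with h2 | h2
      · have : n - 1 = 0 := by omega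
        rw [this, Nat.cast_zero]
        positivity
      · have h : Real.log 2 ≤ Real.log n := Real.log_le_log (by norm_num) (by exact_mod_cast h2)
        calc ((n - 1 : ℕ) : ℝ) ≤ (N + 3 : ℝ) := by exact_mod_cast (by omega : n - 1 ≤ N + 3)
          _ = (N + 3) / Real.log 2 * Real.log 2 := by field_simp
          _ ≤ C * Real.log n := by
            gcongr
            rw [hC]
            exact le_add_of_nonneg_left (by positivity)
    have hempty : {S : Set (Sym2 (PercolatedCM.HalfEdge (d n))) |
        C * Real.log n < (PercolatedCM.maxDiam (PercolatedCM.graph S) : ℝ)} = ∅ := by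
      refine Set.eq_empty_of_forall_notMem fun S hS => absurd hS (not_lt.2 (le_trans ?_ hle))
      exact_mod_cast PercolatedCM.maxDiam_le_pred _
    rw [hempty, measure_empty]
    exact zero_le
  · refine le_trans (measure_mono ?_) (hN n (by omega))
    intro S hS
    have hlog1 : 1 ≤ Real.log n := by
      rw [Real.le_log_iff_exp_le (by exact_mod_cast (by omega : 0 < n))]
      refine Real.exp_one_lt_d9.le.trans ?_
      have : (3 : ℝ) ≤ n := by exact_mod_cast (by omega : 3 ≤ n)
      linarith
    have hr : (⌈2 * Real.log n⌉₊ : ℝ) < 2 * Real.log n + 1 := Nat.ceil_lt_add_one (by positivity)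
    have hS' : C * Real.log n < (PercolatedCM.maxDiam (PercolatedCM.graph S) : ℝ) := hS
    have : ((K + 1) * (⌈2 * Real.log n⌉₊ + 2) : ℝ) ≤
        PercolatedCM.maxDiam (PercolatedCM.graph S) := by
      refine le_trans ?_ hS'.le
      calc ((K + 1) * (⌈2 * Real.log n⌉₊ + 2) : ℝ) ≤ (K + 1) * (5 * Real.log n) := by
            gcongr
            linarith
        _ = 5 * (K + 1) * Real.log n := by ring
        _ ≤ C * Real.log n := by
            gcongr
            rw [hC]
            exact le_add_of_nonneg_right (by positivity)
    exact_mod_cast this
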